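/- Let $E$ be a topological space. The *tandem Banach–Mazur game* on $E$ is played by two players $\beta'$ and $\alpha'$ on two boards. Player $\beta'$ chooses a non-empty open set $V_1$, and $\alpha'$ answers with a non-empty open $V_1'\subset V_1$; then $\beta'$ chooses a non-empty open set $W_1$, and $\alpha'$ answers with a non-empty open $W_1'\subset W_1$. In general, for $k\ge 1$, $\beta'$ chooses a non-empty open $V_{k+1}\subset V_k'$, $\alpha'$ a non-empty open $V_{k+1}'\subset V_{k+1}$, $\beta'$ a non-empty open $W_{k+1}\subset W_k'$, and $\alpha'$ a non-empty open $W_{k+1}'\subset W_{k+1}$. Player $\alpha'$ wins the play if both $\bigcap_{k}V_k\neq\emptyset$ and $\bigcap_k W_k\neq\emptyset$; otherwise $\beta'$ wins. A strategy of a player is a map that assigns, to every finite sequence of non-empty open sets of the appropriate length (all previous moves on both boards), a next move of that player satisfying the inclusion above; a strategy is winning if it beats every strategy of the opponent. The space $E$ is called *$\tau$-Baire* if for every strategy of $\beta'$ there is a strategy of $\alpha'$ which beats it. The game on $E$ is *determined* if $\alpha'$ or $\beta'$ has a winning strategy. **Proposition.** Let $G$ be a metrizable topological group. 1. If $G$ is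 $\tau$-Baire, then $G$ is completely metrizable, and $G$ coincides with its two-sided completion, i.e. the canonical map from $G$ to its completion with respect to the two-sided uniformity (the coarsest uniformity finer than both the left and the right uniformity) is an isomorphism of uniform spaces. 2. The tandem Banach–Mazur game on $G$ is determined. -/

import Mathlib

open TopologicalSpace

/-! ### The tandem Banach-Mazur game

The moves of a play are numbered `0, 1, 2, 3, 4, …` in the order of time, so a play is the sequence
`V₁, V₁', W₁, W₁', V₂, V₂', W₂, W₂', …`.  Player `β'` makes the moves with an even number,
player `α'` those with an odd number.  Thus `V` with (zero-based) index `k` is the move `4 * k`,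
`V'` is `4 * k + 1`, `W` is `4 * k + 2` and `W'` is `4 * k + 3`. -/

namespace TandemGame

/-- A move: a non-empty open subset of `E`. -/
abbrev Move (E : Type*) [TopologicalSpace E] : Type _ := {U : Set E // IsOpen U ∧ U.Nonempty}

/-- A strategy of player `β'`: it assigns to every sequence of `2 * n` non-empty open sets (all the
moves made so far, on both boards) the next move.  The first move on each board (`n = 0`, `n = 1`)
is arbitrary.  For `n ≥ 2` it has to lie in the last answer of `α'` on the same board, which is the
move number `2 * n - 3`, three moves back (`V₂ = m 4` lies in `V₁' = m 1`, `W₂ = m 6` lies in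
`W₁' = m 3`, and so on). -/
structure BetaStrategy (E : Type*) [TopologicalSpace E] where
  move : (n : ℕ) → (Fin (2 * n) → Move E) → Move E
  legal : ∀ (n : ℕ) (hn : 2 ≤ n) (h : Fin (2 * n) → Move E),
    (move n h : Set E) ⊆ (h ⟨2 * n - 3, by omega⟩ : Set E)

/-- A strategy of player `α'`: it assigns to every sequence of `2 * n + 1` non-empty open sets
a next move contained in the last one. -/
structure AlphaStrategy (E : Type*) [TopologicalSpace E] where
  move : (n : ℕ) → (Fin (2 * n + 1) → Move E) → Move E
  legal : ∀ (n : ℕ) (h : Fin (2 * n + 1) → Move E),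
    (move n h : Set E) ⊆ (h ⟨2 * n, by omega⟩ : Set E)

variable {E : Type*} [TopologicalSpace E]

/-- The play of the strategy `α` of player `α'` against the strategy `β` of player `β'`. -/
def play (α : AlphaStrategy E) (β : BetaStrategy E) (n : ℕ) : Move E :=
  if n % 2 = 0 then β.move (n / 2) (fun i : Fin (2 * (n / 2)) => play α β i)
  else α.move (n / 2) (fun i : Fin (2 * (n / 2) + 1) => play α β i)
termination_by n
decreasing_by all_goals omega

/-- `α'` wins the play `m` if the sets chosen on the `V`-board have a common point and so do
those chosen on the `W`-board; otherwise `β'` wins. -/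
def AlphaWins (m : ℕ → Move E) : Prop :=
  (⋂ k : ℕ, (m (4 * k) : Set E)).Nonempty ∧ (⋂ k : ℕ, (m (4 * k + 2) : Set E)).Nonempty

/-- Player `α'` has a winning strategy. -/
def AlphaFavorable (E : Type*) [TopologicalSpace E] : Prop :=
  ∃ α : AlphaStrategy E, ∀ β : BetaStrategy E, AlphaWins (play α β)

/-- Player `β'` has a winning strategy. -/
def BetaFavorable (E : Type*) [TopologicalSpace E] : Prop :=
  ∃ β : BetaStrategy E, ∀ α : AlphaStrategy E, ¬ AlphaWins (play α β)

/-- The tandem game on `E` is determined: one of the two players has a winning strategy. -/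
def Determined (E : Type*) [TopologicalSpace E] : Prop :=
  AlphaFavorable E ∨ BetaFavorable E

end TandemGame

/-- `τ`-Baire spaces: every strategy of `β'` in the tandem game is beaten by some strategy
of `α'`. -/
def IsTauBaire (E : Type*) [TopologicalSpace E] : Prop :=
  ∀ β : TandemGame.BetaStrategy E, ∃ α : TandemGame.AlphaStrategy E,
    TandemGame.AlphaWins (TandemGame.play α β)

/-! ### The two-sided completion -/

/-- The two-sided uniformity of a topological group: the coarsest uniformity that is finer than
both the left and the right uniformity.  It induces the given topology. -/
@[reducible] def twoSidedUniformSpace (G : Type*) [TopologicalSpace G] [Group G]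
    [IsTopologicalGroup G] : UniformSpace G :=
  (IsTopologicalGroup.leftUniformSpace G ⊓ IsTopologicalGroup.rightUniformSpace G).replaceTopology
    (inf_idem _).symm

/-- `G` coincides with its two-sided completion: the canonical map of `G` into its Hausdorff
completion with respect to the two-sided uniformity is an isomorphism of uniform spaces. -/
def CoincidesWithTwoSidedCompletion (G : Type*) [TopologicalSpace G] [Group G]
    [IsTopologicalGroup G] : Prop :=
  letI : UniformSpace G := twoSidedUniformSpace G
  ∃ e : G ≃ᵤ UniformSpace.Completion G, ∀ x : G, e x = (x : UniformSpace.Completion G)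

/-! If the two-sided uniformity of `G` is complete, then `α'` wins by answering on each board with
ever smaller sets whose closures are nested.

Otherwise there is a filter `F` without limit that is Cauchy for this uniformity; so is `F⁻¹`.
Player `β'` always plays a small set whose left translates along `F` (on the `V`-board) or along
`F⁻¹` (on the `W`-board) eventually lie in the last answer of `α'` on the other board. Such a set
exists inside the last answer on the same board, by the Cauchy property and because the previous
move of `β'` was chosen in this way with the inverse filter. If `x` and `y` were common points of
the sets on the `V`-board and the `W`-board, then `g * x` would tend to `y` as `g` runs along `F`,
so that `F` would converge to `y / x`. -/

open Filter Set Topology Uniformity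
open scoped Pointwise

namespace TandemGame

section Play

variable {E : Type*} [TopologicalSpace E] (α : AlphaStrategy E) (β : BetaStrategy E)

theorem play_even (n : ℕ) :
    play α β (2 * n) = β.move n fun i : Fin (2 * n) ↦ play α β i := by
  rw [play, if_pos (Nat.mul_mod_right 2 n), Nat.mul_div_cancel_left n two_pos]

theorem play_odd (n : ℕ) :
    play α β (2 * n + 1) = α.move n fun i : Fin (2 * n + 1) ↦ play α β i := by
  have hn : (2 * n + 1) / 2 = n := by omega
  rw [play, if_neg (by omega), hn]

theorem play_odd_subset (n : ℕ) : (play α β (2 * n + 1) : Set E) ⊆ play α β (2 * n) := by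
  rw [play_odd]
  exact α.legal n _

theorem play_even_subset (n : ℕ) : (play α β (2 * (n + 2)) : Set E) ⊆ play α β (2 * n + 1) := by
  rw [play_even]
  exact β.legal (n + 2) (Nat.le_add_left 2 n) _

end Play

section AlphaFavorable

variable {X : Type*}

theorem exists_move_small_closure_subset [UniformSpace X] (U : Move X) {s : SetRel X X}
    (hs : s ∈ 𝓤 X) :
    ∃ V : Move X, closure (V : Set X) ⊆ U ∧ (V : Set X) ×ˢ (V : Set X) ⊆ s := by
  obtain ⟨x, hx⟩ := U.2.2
  have hclosure : ∀ᶠ V in (𝓝 x).smallSets, closure V ⊆ (U : Set X) := by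
    obtain ⟨C, hC, hCclosed, hCU⟩ := exists_mem_nhds_isClosed_subset (U.2.1.mem_nhds hx)
    filter_upwards [eventually_smallSets_subset.2 hC] with V hV
    exact (closure_minimal hV hCclosed).trans hCU
  have hsmall : ∀ᶠ V in (𝓝 x).smallSets, V ×ˢ V ⊆ s := by
    have hxs : s ∈ 𝓝 x ×ˢ 𝓝 x := by
      rw [← nhds_prod_eq]
      exact nhds_le_uniformity x hs
    obtain ⟨T, hT, hTs⟩ := mem_prod_self_iff.1 hxs
    filter_upwards [eventually_smallSets_subset.2 hT] with V hV
    exact (prod_mono hV hV).trans hTs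
  obtain ⟨V, ⟨hxV, hV⟩, h⟩ :=
    (hclosure.and hsmall).exists_mem_basis_of_smallSets (nhds_basis_opens x)
  exact ⟨⟨V, hV, x, hxV⟩, h⟩

theorem nonempty_iInter_closure_of_small [UniformSpace X] [CompleteSpace X] {V : ℕ → Set X}
    (hanti : Antitone V) (hne : ∀ n, (V n).Nonempty)
    (hsmall : ∀ s ∈ 𝓤 X, ∃ n, V n ×ˢ V n ⊆ s) : (⋂ n, closure (V n)).Nonempty := by
  choose x hx using hne
  have hcauchy : CauchySeq x :=
    cauchySeq_of_controlled (fun n ↦ V n ×ˢ V n) hsmall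
      fun _ m n hm hn ↦ ⟨hanti hm (hx m), hanti hn (hx n)⟩
  obtain ⟨a, ha⟩ := cauchySeq_tendsto_of_complete hcauchy
  refine ⟨a, mem_iInter.2 fun n ↦ mem_closure_of_tendsto ha ?_⟩
  filter_upwards [eventually_ge_atTop n] with m hm
  exact hanti hm (hx m)

/-- The strategy of `α'` that answers `U` in the `n`-th round by `f n U`, irrespective of the
earlier moves. Rounds on both boards are counted together. -/
def AlphaStrategy.ofReply [TopologicalSpace X] (f : ℕ → Move X → Move X)
    (hf : ∀ n U, (f n U : Set X) ⊆ U) : AlphaStrategy X where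
  move n h := f n (h ⟨2 * n, by omega⟩)
  legal n _ := hf n _

theorem alphaFavorable_of_completeSpace (X : Type*) [UniformSpace X] [CompleteSpace X]
    [(𝓤 X).IsCountablyGenerated] : AlphaFavorable X := by
  obtain ⟨s, hs⟩ := (𝓤 X).exists_antitone_basis
  choose f hclosure hsmall using
    fun n (U : Move X) ↦ exists_move_small_closure_subset U (hs.mem n)
  refine ⟨.ofReply f fun n U ↦ subset_closure.trans (hclosure n U), fun β ↦ ?_⟩
  set m := play (.ofReply f fun n U ↦ subset_closure.trans (hclosure n U)) β
  have hodd (n : ℕ) : m (2 * n + 1) = f n (m (2 * n)) := play_odd _ _ n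
  have hboard (b : ℕ) : (⋂ k, (m (2 * (2 * k + b)) : Set X)).Nonempty := by
    have hanti : Antitone fun k ↦ (m (2 * (2 * k + b) + 1) : Set X) :=
      antitone_nat_of_succ_le fun k ↦ by
        rw [show 2 * (k + 1) + b = 2 * k + b + 2 by ring]
        exact (play_odd_subset _ β _).trans (play_even_subset _ β _)
    refine (nonempty_iInter_closure_of_small hanti (fun k ↦ (m _).2.2) fun t ht ↦ ?_).mono
      (iInter_mono fun k ↦ ?_)
    · obtain ⟨n, hn⟩ := hs.mem_iff.1 ht
      refine ⟨n, ?_⟩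
      rw [hodd]
      exact (hsmall _ _).trans ((hs.antitone (by omega)).trans hn)
    · rw [hodd]
      exact hclosure _ _
  have hV := hboard 0
  have hW := hboard 1
  simp only [mul_add, ← mul_assoc] at hV hW
  exact ⟨hV, hW⟩

end AlphaFavorable

section BetaStrategy

variable {E : Type*} [TopologicalSpace E] [Nonempty E]

variable (E) in
/-- The move consisting of the whole space. -/
def univMove : Move E :=
  ⟨univ, isOpen_univ, univ_nonempty⟩

/-- The answers of `α'` in the play `m`, preceded by the whole space on each of the two boards. So
the `n`-th move of `β'` has to lie in `answer m n`, and `answer m (n + 1)` is the last answer on the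
other board. -/
def answer (m : ℕ → Move E) : ℕ → Move E
  | 0 => univMove E
  | 1 => univMove E
  | n + 2 => m (2 * n + 1)

/-- The strategy of `β'` whose `n`-th move is `f n V W`, where `V` is the last answer of `α'` on the
same board and `W` is the last answer on the other board, or the whole space if there is none. -/
def BetaStrategy.ofReply (f : ℕ → Move E → Move E → Move E)
    (hf : ∀ n V W, (f n V W : Set E) ⊆ V) : BetaStrategy E where
  move
    | 0, _ => f 0 (univMove E) (univMove E)
    | 1, h => f 1 (univMove E) (h 1)
    | n + 2, h => f (n + 2) (h ⟨2 * n + 1, by omega⟩) (h ⟨2 * n + 3, by omega⟩)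
  legal
    | _ + 2, _, _ => hf _ _ _

theorem play_ofReply (f : ℕ → Move E → Move E → Move E) (hf : ∀ n V W, (f n V W : Set E) ⊆ V)
    (α : AlphaStrategy E) (n : ℕ) :
    play α (.ofReply f hf) (2 * n) =
      f n (answer (play α (.ofReply f hf)) n) (answer (play α (.ofReply f hf)) (n + 1)) := by
  rw [play_even]
  match n with
  | 0 => rfl
  | 1 => rfl
  | n + 2 => rfl

end BetaStrategy

theorem isTauBaire_of_alphaFavorable {E : Type*} [TopologicalSpace E] (h : AlphaFavorable E) :
    IsTauBaire E := by
  obtain ⟨α, hα⟩ := h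
  exact fun β ↦ ⟨α, hα β⟩

theorem not_isTauBaire_of_betaFavorable {E : Type*} [TopologicalSpace E] (h : BetaFavorable E) :
    ¬ IsTauBaire E := by
  obtain ⟨β, hβ⟩ := h
  intro hE
  obtain ⟨α, hα⟩ := hE β
  exact hβ α hα

end TandemGame

section TwoSidedCauchy

variable {G : Type*} [TopologicalSpace G] [Group G] [IsTopologicalGroup G] {F : Filter G}

/-- Cauchy filters for the two-sided uniformity of a topological group. -/
def TwoSidedCauchy (F : Filter G) : Prop :=
  @Cauchy G (twoSidedUniformSpace G) F

variable (G) in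
theorem uniformity_twoSidedUniformSpace :
    𝓤[twoSidedUniformSpace G] =
      comap (fun p : G × G ↦ p.1⁻¹ * p.2) (𝓝 1) ⊓ comap (fun p : G × G ↦ p.2 * p.1⁻¹) (𝓝 1) :=
  rfl

theorem twoSidedCauchy_iff :
    TwoSidedCauchy F ↔ F.NeBot ∧ Tendsto (fun p : G × G ↦ p.1⁻¹ * p.2) (F ×ˢ F) (𝓝 1) ∧
      Tendsto (fun p : G × G ↦ p.2 * p.1⁻¹) (F ×ˢ F) (𝓝 1) := by
  unfold TwoSidedCauchy Cauchy
  rw [uniformity_twoSidedUniformSpace, le_inf_iff, ← tendsto_iff_comap, ← tendsto_iff_comap]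

theorem TwoSidedCauchy.inv (hF : TwoSidedCauchy F) : TwoSidedCauchy F⁻¹ := by
  obtain ⟨hne, hl, hr⟩ := twoSidedCauchy_iff.1 hF
  have hprod : F⁻¹ ×ˢ F⁻¹ = map (Prod.map Inv.inv Inv.inv) (F ×ˢ F) := prod_map_map_eq
  refine twoSidedCauchy_iff.2 ⟨inferInstance, ?_, ?_⟩ <;> rw [hprod, tendsto_map'_iff]
  · simpa [Function.comp_def] using hr.inv
  · simpa [Function.comp_def] using hl.inv

instance isCountablyGenerated_uniformity_twoSidedUniformSpace [FirstCountableTopology G] :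
    𝓤[twoSidedUniformSpace G].IsCountablyGenerated := by
  rw [uniformity_twoSidedUniformSpace]
  infer_instance

end TwoSidedCauchy

namespace TandemGame

section Translation

variable {G : Type*} [Group G]

/-- The filter along which the moves of `β'` on the board of its `n`-th move are translated:
`F` on the `V`-board and `F⁻¹` on the `W`-board. -/
def boardFilter (F : Filter G) (n : ℕ) : Filter G :=
  if Even n then F else F⁻¹

theorem boardFilter_succ (F : Filter G) (n : ℕ) :
    boardFilter F (n + 1) = (boardFilter F n)⁻¹ := by
  by_cases hn : Even n <;> simp [boardFilter, hn, Nat.even_add_one]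

variable [TopologicalSpace G]

/-- The requirements on a move `U` of `β'` inside `V` that answers the move `W` on the other board:
it is small in the sense of the neighborhood `B` of `1`, and it is translated into `W` eventually
along `H`. -/
structure IsTranslationReply (H : Filter G) (B V W U : Set G) : Prop where
  subset : U ⊆ V
  div_subset : U / U ⊆ B
  eventually_mapsTo : ∀ᶠ h in H, MapsTo (h * ·) U W

variable {F H : Filter G} {B : ℕ → Set G}

theorem exists_le_nhds_of_alphaWins [IsTopologicalGroup G] (hB : (𝓝 (1 : G)).HasAntitoneBasis B)
    {m : ℕ → Move G} (hodd : ∀ n, (m (2 * n + 1) : Set G) ⊆ m (2 * n))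
    (hm : ∀ n, IsTranslationReply (boardFilter F n) (B n) (answer m n) (answer m (n + 1))
      (m (2 * n)))
    (hwin : AlphaWins m) : ∃ x, F ≤ 𝓝 x := by
  obtain ⟨⟨x, hx⟩, y, hy⟩ := hwin
  have hxy : Tendsto (fun g ↦ g * x / y) F (𝓝 1) := by
    refine hB.tendsto_right_iff.2 fun k _ ↦ ?_
    have hxV : x ∈ (m (2 * (2 * k + 2)) : Set G) := by
      convert mem_iInter.1 hx (k + 1) using 3; ring
    have hyW : y ∈ (m (2 * (2 * k + 1)) : Set G) := by
      convert mem_iInter.1 hy k using 3; ring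
    have htranslate : ∀ᶠ g in F, MapsTo (g * ·) (m (2 * (2 * k + 2)) : Set G)
        (m (2 * (2 * k + 1) + 1)) := by
      have heven : boardFilter F (2 * k + 2) = F := if_pos (by simp [Nat.even_add])
      rw [← heven]
      exact (hm (2 * k + 2)).eventually_mapsTo
    filter_upwards [htranslate] with g hg
    have hgxW : g * x ∈ (m (2 * (2 * k + 1)) : Set G) := hodd _ (hg hxV)
    exact hB.antitone (by omega) ((hm (2 * k + 1)).div_subset (div_mem_div hgxW hyW))
  refine ⟨y / x, ?_⟩
  simpa [Tendsto, div_eq_mul_inv, mul_assoc] using hxy.mul_const (y / x)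

variable [IsTopologicalGroup G]

theorem twoSidedCauchy_boardFilter (hF : TwoSidedCauchy F) (n : ℕ) :
    TwoSidedCauchy (boardFilter F n) := by
  unfold boardFilter
  split_ifs
  exacts [hF, hF.inv]

theorem exists_isTranslationReply [H.NeBot]
    (hH : Tendsto (fun p : G × G ↦ p.2 * p.1⁻¹) (H ×ˢ H) (𝓝 1)) {B : Set G} (hB : B ∈ 𝓝 1)
    {V W : Move G} (hWV : ∀ᶠ h in H, MapsTo (h⁻¹ * ·) (W : Set G) V) :
    ∃ U : Move G, IsTranslationReply H B V W U := by
  obtain ⟨w, hw⟩ := W.2.2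
  have hmul : Tendsto (fun p : G × G ↦ p.1 * p.2) (𝓝 1 ×ˢ 𝓝 w) (𝓝 w) := by
    simpa only [nhds_prod_eq, one_mul] using (continuous_mul (M := G)).tendsto (1, w)
  obtain ⟨O, hO, P, hP, hOP⟩ := mem_prod_iff.1 (hmul (W.2.1.mem_nhds hw))
  have hcauchy : ∀ᶠ a in H, ∀ᶠ h in H, h * a⁻¹ ∈ O := Eventually.curry (hH hO)
  obtain ⟨a, haO, haV⟩ := (hcauchy.and hWV).exists
  have hsubset : ∀ᶠ U in (𝓝 (a⁻¹ * w)).smallSets, U ⊆ (V : Set G) :=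
    eventually_smallSets_subset.2 (V.2.1.mem_nhds (haV hw))
  have hsmall : ∀ᶠ U in (𝓝 (a⁻¹ * w)).smallSets, U / U ⊆ B := by
    have hdiv : Tendsto (fun p : G × G ↦ p.1 / p.2) (𝓝 (a⁻¹ * w) ×ˢ 𝓝 (a⁻¹ * w)) (𝓝 1) := by
      simpa only [nhds_prod_eq, div_self'] using
        (continuous_div' (G := G)).tendsto (a⁻¹ * w, a⁻¹ * w)
    obtain ⟨T, hT, hTB⟩ := mem_prod_self_iff.1 (hdiv hB)
    filter_upwards [eventually_smallSets_subset.2 hT] with U hU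
    exact div_subset_iff.2 fun x hx y hy ↦ hTB (mk_mem_prod (hU hx) (hU hy))
  have htranslate : ∀ᶠ U in (𝓝 (a⁻¹ * w)).smallSets, ∀ᶠ h in H, MapsTo (h * ·) U (W : Set G) := by
    have haP : (a * ·) ⁻¹' P ∈ 𝓝 (a⁻¹ * w) :=
      (continuous_const_mul a).continuousAt.preimage_mem_nhds (by simpa using hP)
    filter_upwards [eventually_smallSets_subset.2 haP] with U hU
    filter_upwards [haO] with h hh x hx
    simpa [mul_assoc] using hOP (mk_mem_prod hh (hU hx))
  obtain ⟨U, ⟨hwU, hU⟩, hUV, hUB, hUW⟩ :=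
    (hsubset.and (hsmall.and htranslate)).exists_mem_basis_of_smallSets (nhds_basis_opens _)
  exact ⟨⟨U, hU, _, hwU⟩, hUV, hUB, hUW⟩

theorem exists_betaStrategy_isTranslationReply (hF : TwoSidedCauchy F) (hB : ∀ n, B n ∈ 𝓝 1) :
    ∃ β : BetaStrategy G, ∀ α n, IsTranslationReply (boardFilter F n) (B n)
      (answer (play α β) n) (answer (play α β) (n + 1)) (play α β (2 * n)) := by
  have hreply (n : ℕ) (V W : Move G) : ∃ U : Move G, (U : Set G) ⊆ V ∧
      ((∀ᶠ h in boardFilter F n, MapsTo (h⁻¹ * ·) (W : Set G) V) →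
        IsTranslationReply (boardFilter F n) (B n) V W U) := by
    by_cases hWV : ∀ᶠ h in boardFilter F n, MapsTo (h⁻¹ * ·) (W : Set G) V
    · obtain ⟨_, -, hright⟩ := twoSidedCauchy_iff.1 (twoSidedCauchy_boardFilter hF n)
      obtain ⟨U, hU⟩ := exists_isTranslationReply hright (hB n) hWV
      exact ⟨U, hU.subset, fun _ ↦ hU⟩
    · exact ⟨V, Subset.rfl, fun h ↦ absurd h hWV⟩
  choose f hfV hf using hreply
  refine ⟨.ofReply f hfV, fun α n ↦ ?_⟩
  set m := play α (.ofReply f hfV)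
  have hplay (n : ℕ) : m (2 * n) = f n (answer m n) (answer m (n + 1)) := play_ofReply f hfV α n
  suffices hback : ∀ᶠ h in boardFilter F n,
      MapsTo (h⁻¹ * ·) (answer m (n + 1) : Set G) (answer m n) by
    rw [hplay]
    exact hf n _ _ hback
  induction n with
  | zero => exact Eventually.of_forall fun _ ↦ mapsTo_univ _ _
  | succ n ih =>
    have hforth : ∀ᶠ h in boardFilter F n,
        MapsTo (h * ·) (m (2 * n) : Set G) (answer m (n + 1)) := by
      rw [hplay]
      exact (hf n _ _ ih).eventually_mapsTo
    rw [boardFilter_succ, ← Filter.map_inv, eventually_map]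
    filter_upwards [hforth] with h hh
    rw [inv_inv]
    exact hh.mono_left (play_odd_subset α _ n)

end Translation

end TandemGame

section TwoSidedCompleteness

variable {G : Type*} [TopologicalSpace G] [Group G] [IsTopologicalGroup G]

theorem betaFavorable_of_twoSidedCauchy [FirstCountableTopology G] {F : Filter G}
    (hF : TwoSidedCauchy F) (hlim : ∀ x, ¬ F ≤ 𝓝 x) : TandemGame.BetaFavorable G := by
  obtain ⟨B, hB⟩ := (𝓝 (1 : G)).exists_antitone_basis
  obtain ⟨β, hβ⟩ := TandemGame.exists_betaStrategy_isTranslationReply hF hB.mem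
  refine ⟨β, fun α hα ↦ ?_⟩
  obtain ⟨x, hx⟩ :=
    TandemGame.exists_le_nhds_of_alphaWins hB (TandemGame.play_odd_subset α β) (hβ α) hα
  exact hlim x hx

theorem betaFavorable_of_not_completeSpace_twoSided [FirstCountableTopology G]
    (h : ¬ @CompleteSpace G (twoSidedUniformSpace G)) : TandemGame.BetaFavorable G := by
  contrapose! h
  refine @CompleteSpace.mk G (twoSidedUniformSpace G) fun {F} hF ↦ ?_
  by_contra! hlim
  exact h (betaFavorable_of_twoSidedCauchy hF hlim)

theorem alphaFavorable_of_completeSpace_twoSided [FirstCountableTopology G]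
    (h : @CompleteSpace G (twoSidedUniformSpace G)) : TandemGame.AlphaFavorable G :=
  @TandemGame.alphaFavorable_of_completeSpace G (twoSidedUniformSpace G) h inferInstance

theorem isCompletelyMetrizableSpace_of_completeSpace_twoSided [FirstCountableTopology G] [T0Space G]
    (h : @CompleteSpace G (twoSidedUniformSpace G)) : IsCompletelyMetrizableSpace G := by
  let : UniformSpace G := twoSidedUniformSpace G
  infer_instance

theorem coincidesWithTwoSidedCompletion_of_completeSpace [T0Space G]
    (h : @CompleteSpace G (twoSidedUniformSpace G)) : CoincidesWithTwoSidedCompletion G := by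
  let : UniformSpace G := twoSidedUniformSpace G
  exact ⟨AbstractCompletion.ofComplete.compareEquiv UniformSpace.Completion.cPkg,
    AbstractCompletion.compare_coe _ _⟩

end TwoSidedCompleteness

theorem proposition7p2_general (G : Type*) [TopologicalSpace G] [Group G] [IsTopologicalGroup G]
    [FirstCountableTopology G] :
    (IsTauBaire G ↔ @CompleteSpace G (twoSidedUniformSpace G)) ∧ TandemGame.Determined G := by
  by_cases h : @CompleteSpace G (twoSidedUniformSpace G)
  · have hα := alphaFavorable_of_completeSpace_twoSided h
    exact ⟨iff_of_true (TandemGame.isTauBaire_of_alphaFavorable hα) h, Or.inl hα⟩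
  · have hβ := betaFavorable_of_not_completeSpace_twoSided h
    exact ⟨iff_of_false (TandemGame.not_isTauBaire_of_betaFavorable hβ) h, Or.inr hβ⟩

theorem proposition7p2 (G : Type*) [TopologicalSpace G] [Group G] [IsTopologicalGroup G]
    [MetrizableSpace G] :
    (IsTauBaire G → IsCompletelyMetrizableSpace G ∧ CoincidesWithTwoSidedCompletion G) ∧
      TandemGame.Determined G :=
  (proposition7p2_general G).imp_left fun hiff hG ↦
    ⟨isCompletelyMetrizableSpace_of_completeSpace_twoSided (hiff.1 hG),
      coincidesWithTwoSidedCompletion_of_completeSpace (hiff.1 hG)⟩
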